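/- Let $J(10,3)$ be the Johnson graph whose vertices are the $3$-subsets of a $10$-set, two being adjacent when they meet in exactly $2$ points. A perfect $2$-coloring of it with quotient matrix $[p_{ij}]$ is a partition of the vertices into two nonempty parts $X_1,X_2$ such that every vertex of $X_i$ has exactly $p_{ij}$ neighbours in $X_j$. Two such colorings are isomorphic if an automorphism of the graph maps the unordered pair of parts of one onto that of the other. A set $X$ of vertices is of type $t\in\{0,1,2\}$ if, for all distinct points $a,b$, the number of triples in $X$ containing $a$ and $b$ is congruent to $t$ modulo $3$. Put $\theta_2=(3-2)(10-3-2)-2=3$. Let the $10$ points be the vertices of a $10$-cycle with graph distance $d$, and let $O_{pqr}$ be the set of triples that can be written $\{a,b,c\}$ with $d(a,b)=p$, $d(b,c)=q$, $d(a,c)=r$. Put $A=O_{112}$, $B=O_{123}$, $C=O_{134}$, $D=O_{145}$, $E=O_{224}$, $F=O_{235}$, $G=O_{244}$, $H=O_{334}$, and $$P_1=A\cup B\cup C\cup H,\quad P_2=D\cup E\cup F\cup G,\quad P_1'=C\cup D\cup G\cup H,\quad P_2'=A\cup B\cup E\cup F.$$ **Theorem.** (1) $\{P_1',P_2'\}$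 is a perfect $2$-coloring of $J(10,3)$ with quotient matrix $\begin{bmatrix}12&9\\9&12\end{bmatrix}$, both its parts are of type $1$, and some automorphism of $J(10,3)$ maps $P_1'$ onto $P_2'$. Every perfect $2$-coloring of $J(10,3)$ with this quotient matrix and with a part of type $1$ is isomorphic to $\{P_1',P_2'\}$. (2) The perfect $2$-colorings of $J(10,3)$ whose quotient matrix is symmetric and has the eigenvalue $\theta_2$ are exactly those with quotient matrix $\begin{bmatrix}12&9\\9&12\end{bmatrix}$. Up to isomorphism there are exactly two of them: $\{P_1,P_2\}$, where $P_1$ is of type $0$ and $P_2$ of type $2$, and $\{P_1',P_2'\}$; these two are not isomorphic. -/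

import Mathlib

/-- The vertices of the Johnson graph `J(n,k)`: the `k`-element subsets of an `n`-element set. -/
abbrev JohnsonVertex (n k : ℕ) : Type := {s : Finset (Fin n) // s.card = k}

/-- The Johnson graph `J(n,k)`: two `k`-subsets are adjacent when they meet in exactly `k - 1`
points. -/
def johnsonGraph (n k : ℕ) : SimpleGraph (JohnsonVertex n k) where
  Adj s t := (s.1 ∩ t.1).card + 1 = k
  symm := ⟨fun s t h => by rw [Finset.inter_comm]; exact h⟩
  loopless := ⟨fun s h => by
    have h2 := s.2
    rw [Finset.inter_self] at h
    omega⟩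

instance johnsonGraphDecidableAdj (n k : ℕ) : DecidableRel (johnsonGraph n k).Adj :=
  fun s t => inferInstanceAs (Decidable ((s.1 ∩ t.1).card + 1 = k))

/-- The number `θ_i = (k - i)(n - k - i) - i`, the `i`-th eigenvalue of `J(n,k)`. -/
def johnsonEigenvalue (n k i : ℕ) : ℝ :=
  ((k : ℝ) - i) * ((n : ℝ) - k - i) - i

/-- `P` is a perfect coloring of the graph `G` into `m` (nonempty) parts with quotient
matrix `M`: the parts `P i` partition the vertices, and every vertex of `P i` has exactly `M i j`
neighbours in `P j`. -/
structure IsPerfectColoring {V : Type*} [Fintype V] [DecidableEq V] (G : SimpleGraph V)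
    [DecidableRel G.Adj] {m : ℕ} (P : Fin m → Finset V) (M : Matrix (Fin m) (Fin m) ℕ) :
    Prop where
  nonempty : ∀ i, (P i).Nonempty
  disjoint : ∀ i j, i ≠ j → Disjoint (P i) (P j)
  cover : ∀ x, ∃ i, x ∈ P i
  count : ∀ i j, ∀ x ∈ P i, (G.neighborFinset x ∩ P j).card = M i j

/-- Two colorings of `G` are isomorphic when some automorphism of `G` maps the (unordered)
collection of parts of the first onto that of the second. -/
def ColoringIso {V : Type*} (G : SimpleGraph V) {m : ℕ} (P Q : Fin m → Finset V) : Prop :=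
  ∃ (φ : G ≃g G) (σ : Equiv.Perm (Fin m)), ∀ i x, x ∈ P i ↔ φ x ∈ Q (σ i)

/-- `P` is a perfect `2`-coloring of `J(n,k)` whose quotient matrix is symmetric and has the
eigenvalue `θ_2`. -/
def IsSymmetricThetaTwoColoring (n k : ℕ) (P : Fin 2 → Finset (JohnsonVertex n k)) : Prop :=
  ∃ M : Matrix (Fin 2) (Fin 2) ℕ,
    IsPerfectColoring (johnsonGraph n k) P M ∧ M.IsSymm ∧
      Module.End.HasEigenvalue (Matrix.toLin' (M.map (fun a => (a : ℝ))))
        (johnsonEigenvalue n k 2)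

/-- The set `X` of triples is of type `t ∈ {0,1,2}`: for all distinct `a, b`, the number of
triples of `X` containing both `a` and `b` is congruent to `t` modulo `3`. -/
def IsOfType {n : ℕ} (X : Finset (JohnsonVertex n 3)) (t : Fin 3) : Prop :=
  ∀ a b : Fin n, a ≠ b → (X.filter (fun s => a ∈ s.1 ∧ b ∈ s.1)).card % 3 = t.val

/-- The distance of two vertices of the cycle on the `10` vertices `0, 1, …, 9` (subtraction is
modulo `10`). -/
def cycleDist (a b : Fin 10) : ℕ := min (a - b).val (b - a).val

/-- The triples `{a,b,c}` of vertices of the `10`-cycle with `d(a,b) = p`, `d(b,c) = q`,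
`d(a,c) = r` for a suitable naming of their elements. -/
def cycleOrbit (p q r : ℕ) : Finset (JohnsonVertex 10 3) :=
  Finset.univ.filter (fun s => ∃ a b c : Fin 10,
    s.1 = {a, b, c} ∧ cycleDist a b = p ∧ cycleDist b c = q ∧ cycleDist a c = r)

/-- The eight orbits of the automorphism group of the `10`-cycle on triples. -/
def orbitA : Finset (JohnsonVertex 10 3) := cycleOrbit 1 1 2
def orbitB : Finset (JohnsonVertex 10 3) := cycleOrbit 1 2 3
def orbitC : Finset (JohnsonVertex 10 3) := cycleOrbit 1 3 4
def orbitD : Finset (JohnsonVertex 10 3) := cycleOrbit 1 4 5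
def orbitE : Finset (JohnsonVertex 10 3) := cycleOrbit 2 2 4
def orbitF : Finset (JohnsonVertex 10 3) := cycleOrbit 2 3 5
def orbitG : Finset (JohnsonVertex 10 3) := cycleOrbit 2 4 4
def orbitH : Finset (JohnsonVertex 10 3) := cycleOrbit 3 3 4

/-- The coloring `{P₁, P₂}`. -/
def coloringP : Fin 2 → Finset (JohnsonVertex 10 3) :=
  ![orbitA ∪ orbitB ∪ orbitC ∪ orbitH, orbitD ∪ orbitE ∪ orbitF ∪ orbitG]

/-- The coloring `{P₁', P₂'}`. -/
def coloringP' : Fin 2 → Finset (JohnsonVertex 10 3) :=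
  ![orbitC ∪ orbitD ∪ orbitG ∪ orbitH, orbitA ∪ orbitB ∪ orbitE ∪ orbitF]

/-- The symmetric quotient matrix under consideration. -/
def quotientMatrix : Matrix (Fin 2) (Fin 2) ℕ := !![12, 9; 9, 12]

/-!
Let `S` be a part of a perfect coloring of `J(10,3)` with quotient matrix `[12, 9; 9, 12]`, let
`d(a,b)` be the number of triples of `S` containing `a` and `b`, and put `w(a,b) = d(a,b) - 4`.
Counting the triples that meet `{a,b,c}` in at least two points gives
`d(a,b) + d(b,c) + d(a,c) = 15` if `{a,b,c}` is in `S` and `9` otherwise (`pairDegree_add_add`,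
`IsPerfectColoring.isHalf`), so `w` sums to `3` or `-3` on every triangle, and `S` is recovered from
`w`. Summing over `c` shows that `w` also sums to `0` around each point (`IsHalf.isBalancedWeight`).

Four triangles on four points show that disjoint pairs have congruent weights modulo `3`, so all
weights are congruent (`IsBalancedWeight.exists_emod_eq`): each part has a type. As `|w| ≤ 4`, only
few values remain.

* Type `1`: the values are `0` and `±3`. Triangle sums are odd multiples of `3`, so a triangle has
  one or three nonzero weights, and "nonzero weight" is an equivalence relation with at most two
  classes. No three points are joined by equal nonzero weights; with the zero row sums this forces
  two classes of five points, each a pentagon with weight `3` on its sides and `-3` on its diagonals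
  (`IsBalancedWeight.exists_pentagon_labelling`).
* Type `2`: the values are `4`, `1` and `-2`. Now "weight `1`" is an equivalence relation, and the
  row sums force two classes of five points and a perfect matching of weight `4` between them
  (`IsBalancedWeight.exists_matching_labelling`).
* Type `0`: the other part has type `2`.

In each case the weight is unique up to a permutation of the points, so the coloring is unique up to
isomorphism (`IsHalf.exists_iso`). The explicit colorings are checked through their pair degrees,
which depend only on the distance in the ten-cycle. They are told apart by an invariant of the graph
alone: an edge lying in one part together with all common neighbours of its ends
(`HasSaturatedEdge`). Finally a symmetric quotient matrix has row sums `21`, and its other eigenvalue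
is `3` exactly when its off-diagonal entries are `9`.
-/

/-! ### Balanced weights -/

/-- A symmetric integer weight on the pairs of a finite set that sums to `±3` on every triangle
and to `0` around every point. Diagonal values are irrelevant. -/
structure IsBalancedWeight {α : Type*} [Fintype α] [DecidableEq α] (w : α → α → ℤ) : Prop where
  symm : ∀ a b, w a b = w b a
  triangle : ∀ a b c, a ≠ b → b ≠ c → a ≠ c →
    w a b + w b c + w a c = 3 ∨ w a b + w b c + w a c = -3
  row : ∀ a, ∑ b ∈ Finset.univ.erase a, w a b = 0

/-- Two pentagons with weight `3` on their sides, `-3` on their diagonals and `0` between them. -/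
def pentagonWeight (p q : Fin 2 × Fin 5) : ℤ :=
  if p.1 = q.1 then if p.2 - q.2 = 1 ∨ q.2 - p.2 = 1 then 3 else -3 else 0

/-- Two complete graphs of weight `1`, joined by a perfect matching of weight `4`; the other pairs
have weight `-2`. -/
def matchingWeight (p q : Fin 2 × Fin 5) : ℤ :=
  if p.1 = q.1 then 1 else if p.2 = q.2 then 4 else -2

namespace IsBalancedWeight

variable {α : Type*} [Fintype α] [DecidableEq α] {w : α → α → ℤ}

/-- Combining the four triangles on `{a, b, c, d}` with signs leaves `2 (w a b - w c d)`. -/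
theorem emod_eq_of_disjoint (h : IsBalancedWeight w) {a b c d : α} (hab : a ≠ b) (hac : a ≠ c)
    (had : a ≠ d) (hbc : b ≠ c) (hbd : b ≠ d) (hcd : c ≠ d) : w a b % 3 = w c d % 3 := by
  have h1 := h.triangle a b c hab hbc hac
  have h2 := h.triangle a b d hab hbd had
  have h3 := h.triangle a c d hac hcd had
  have h4 := h.triangle b c d hbc hcd hbd
  omega

theorem exists_emod_eq (h : IsBalancedWeight w) (hα : 6 ≤ Fintype.card α) :
    ∃ t : ℤ, ∀ a b, a ≠ b → w a b % 3 = t := by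
  have key : ∀ a b c d : α, a ≠ b → c ≠ d → w a b % 3 = w c d % 3 := by
    intro a b c d hab hcd
    -- a pair disjoint from both links the two given pairs
    have h4 : ({a, b, c, d} : Finset α).card ≤ 4 := Finset.card_le_four
    have h2 : 1 < (({a, b, c, d} : Finset α)ᶜ).card := by
      rw [Finset.card_compl]; omega
    obtain ⟨x, hx, y, hy, hxy⟩ := Finset.one_lt_card.1 h2
    simp only [Finset.mem_compl, Finset.mem_insert, Finset.mem_singleton, not_or] at hx hy
    rw [h.emod_eq_of_disjoint hab (Ne.symm hx.1) (Ne.symm hy.1) (Ne.symm hx.2.1)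
      (Ne.symm hy.2.1) hxy]
    exact h.emod_eq_of_disjoint hxy hx.2.2.1 hx.2.2.2 hy.2.2.1 hy.2.2.2 hcd
  have : 1 < Fintype.card α := by omega
  obtain ⟨x, y, hxy⟩ := Fintype.one_lt_card_iff.1 this
  exact ⟨w x y % 3, fun a b hab => key a b x y hab hxy⟩

/-- The points other than `a` that are joined to `a` with weight `k`. -/
def fiber (w : α → α → ℤ) (a : α) (k : ℤ) : Finset α :=
  (Finset.univ.erase a).filter (fun b => w a b = k)

theorem mem_fiber {a b : α} {k : ℤ} : b ∈ fiber w a k ↔ b ≠ a ∧ w a b = k := by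
  simp [fiber]

/-- The points around `a`, and the row sum at `a`, split according to the three values. -/
theorem card_fibers (h : IsBalancedWeight w) (a : α) {i j k : ℤ} (hij : i ≠ j) (hik : i ≠ k)
    (hjk : j ≠ k) (hv : ∀ b, b ≠ a → w a b = i ∨ w a b = j ∨ w a b = k) :
    (fiber w a i).card + (fiber w a j).card + (fiber w a k).card + 1 = Fintype.card α ∧
      i * (fiber w a i).card + j * (fiber w a j).card + k * (fiber w a k).card = 0 := by
  constructor
  · have h1 : (Finset.univ.erase a).card + 1 = Fintype.card α := by
      rw [Finset.card_erase_add_one (Finset.mem_univ a), Finset.card_univ]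
    rw [← h1, Finset.card_eq_sum_ones (Finset.univ.erase a)]
    simp only [fiber, Finset.card_filter]
    rw [← Finset.sum_add_distrib, ← Finset.sum_add_distrib]
    congr 1
    refine Finset.sum_congr rfl fun b hb => ?_
    rcases hv b (Finset.ne_of_mem_erase hb) with e | e | e <;>
      simp [e, hij, hik, hjk, hij.symm, hik.symm, hjk.symm]
  · rw [← h.row a]
    simp only [fiber, Finset.card_filter]
    push_cast
    rw [Finset.mul_sum, Finset.mul_sum, Finset.mul_sum, ← Finset.sum_add_distrib,
      ← Finset.sum_add_distrib]
    refine Finset.sum_congr rfl fun b hb => ?_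
    rcases hv b (Finset.ne_of_mem_erase hb) with e | e | e <;>
      simp [e, hij, hik, hjk, hij.symm, hik.symm, hjk.symm]

/-! ### Weights divisible by three -/

/-- Three points joined to `a` with the same weight `ε = ±3` would be pairwise joined with weight
`-ε`, and their triangle would have sum `∓9`. -/
theorem card_fiber_le_two (h : IsBalancedWeight w) (a : α) {ε : ℤ} (hε : ε = 3 ∨ ε = -3)
    (hv : ∀ a b, a ≠ b → w a b = 3 ∨ w a b = -3 ∨ w a b = 0) : (fiber w a ε).card ≤ 2 := by
  by_contra! hc
  obtain ⟨x, y, z, hx, hy, hz, hxy, hxz, hyz⟩ := Finset.two_lt_card_iff.1 hc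
  rw [mem_fiber] at hx hy hz
  have h1 := h.triangle a x y hx.1.symm hxy hy.1.symm
  have h2 := h.triangle a y z hy.1.symm hyz hz.1.symm
  have h3 := h.triangle a x z hx.1.symm hxz hz.1.symm
  have h4 := h.triangle x y z hxy hyz hxz
  have := hv x y hxy
  have := hv y z hyz
  have := hv x z hxz
  omega

theorem card_fibers_of_zero (h : IsBalancedWeight w) (hα : Fintype.card α = 10)
    (hv : ∀ a b, a ≠ b → w a b = 3 ∨ w a b = -3 ∨ w a b = 0) (a : α) :
    (fiber w a 3).card = 2 ∧ (fiber w a (-3)).card = 2 ∧ (fiber w a 0).card = 5 := by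
  have h0 := h.card_fibers a (i := 3) (j := -3) (k := 0) (by norm_num) (by norm_num) (by norm_num)
    (fun b hb => hv a b hb.symm)
  have h1 := h.card_fiber_le_two a (Or.inl rfl) hv
  have h2 := h.card_fiber_le_two a (Or.inr rfl) hv
  have h3 : (fiber w a 0).card ≤ 5 := by
    rcases (fiber w a 0).eq_empty_or_nonempty with he | ⟨z, hz⟩
    · simp [he]
    · -- the points of the zero fiber are joined to one of them, `z`, with nonzero weight
      have hsub : fiber w a 0 ⊆ insert z (fiber w z 3 ∪ fiber w z (-3)) := by
        intro x hx
        rw [mem_fiber] at hx hz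
        simp only [Finset.mem_insert, Finset.mem_union, mem_fiber]
        by_cases hxz : x = z
        · exact Or.inl hxz
        · have := h.triangle a z x hz.1.symm (Ne.symm hxz) hx.1.symm
          have := hv z x (Ne.symm hxz)
          have : w z x = 3 ∨ w z x = -3 := by omega
          tauto
      have h4 := h.card_fiber_le_two z (Or.inl rfl) hv
      have h5 := h.card_fiber_le_two z (Or.inr rfl) hv
      have := Finset.card_le_card hsub
      have := Finset.card_insert_le z (fiber w z 3 ∪ fiber w z (-3))
      have := Finset.card_union_le (fiber w z 3) (fiber w z (-3))
      omega
  omega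

/-- Triangles with one or three nonzero weights: being equal or joined with nonzero weight is an
equivalence relation. -/
theorem eq_zero_of_ne_zero (h : IsBalancedWeight w)
    (hv : ∀ a b, a ≠ b → w a b = 3 ∨ w a b = -3 ∨ w a b = 0) {a b c : α} (hab : a ≠ b)
    (hbc : b ≠ c) (hac : a ≠ c) (h0 : w a b = 0) (h1 : w b c ≠ 0) : w a c = 0 := by
  have := h.triangle a b c hab hbc hac
  have := hv a c hac
  have := hv b c hbc
  omega

/-- The points joined to `a` with nonzero weight form with `a` a pentagon, its sides having
weight `3` and its diagonals `-3`. -/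
theorem exists_pentagon (h : IsBalancedWeight w) (hα : Fintype.card α = 10)
    (hv : ∀ a b, a ≠ b → w a b = 3 ∨ w a b = -3 ∨ w a b = 0) (a : α) :
    ∃ c : Fin 5 → α, c 0 = a ∧ Function.Injective c ∧
      ∀ x y, x ≠ y → w (c x) (c y) = if x - y = 1 ∨ y - x = 1 then 3 else -3 := by
  obtain ⟨hp, hn, -⟩ := h.card_fibers_of_zero hα hv a
  obtain ⟨p, q, hpq, hP⟩ := Finset.card_eq_two.1 hp
  obtain ⟨r, s, hrs, hN⟩ := Finset.card_eq_two.1 hn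
  have mp : p ∈ fiber w a 3 := by simp [hP]
  have mq : q ∈ fiber w a 3 := by simp [hP]
  have mr : r ∈ fiber w a (-3) := by simp [hN]
  have ms : s ∈ fiber w a (-3) := by simp [hN]
  rw [mem_fiber] at mp mq mr ms
  obtain ⟨hpa, mp⟩ := mp
  obtain ⟨hqa, mq⟩ := mq
  obtain ⟨hra, mr⟩ := mr
  obtain ⟨hsa, ms⟩ := ms
  have hpr : p ≠ r := by rintro rfl; omega
  have hps : p ≠ s := by rintro rfl; omega
  have hqr : q ≠ r := by rintro rfl; omega
  have hqs : q ≠ s := by rintro rfl; omega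
  -- a fiber of weight `±3` has no third element
  have third : ∀ {k : ℤ} (_ : k = 3 ∨ k = -3) {v x y z : α}, v ≠ x → v ≠ y → v ≠ z → x ≠ y →
      x ≠ z → y ≠ z → w v x = k → w v y = k → w v z ≠ k := by
    intro k hk v x y z hx hy hz hxy hxz hyz ex ey ez
    have hc : 2 < (fiber w v k).card := Finset.two_lt_card_iff.2
      ⟨x, y, z, mem_fiber.2 ⟨hx.symm, ex⟩, mem_fiber.2 ⟨hy.symm, ey⟩, mem_fiber.2 ⟨hz.symm, ez⟩,
        hxy, hxz, hyz⟩
    have := h.card_fiber_le_two v hk hv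
    omega
  have hpq' : w p q = -3 := by
    have := h.triangle a p q hpa.symm hpq hqa.symm
    have := hv p q hpq
    omega
  have hrs' : w r s = 3 := by
    have := h.triangle a r s hra.symm hrs hsa.symm
    have := hv r s hrs
    omega
  -- points joined to `a` with different signs are joined with nonzero weight
  have mixed : ∀ x y, x ≠ a → y ≠ a → x ≠ y → w a x = 3 → w a y = -3 → w x y = 3 ∨ w x y = -3 := by
    intro x y hx hy hxy ex ey
    have := h.triangle a x y hx.symm hxy hy.symm
    have := hv x y hxy
    omega
  -- it remains to name the two points joined to `a` with weight `-3` in the right order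
  have build : ∀ u v : α, u ≠ v → p ≠ u → p ≠ v → q ≠ u → q ≠ v → u ≠ a → v ≠ a →
      w a u = -3 → w a v = -3 → w p q = -3 → w u v = 3 → w p u = 3 → w p v = -3 → w q u = -3 →
      w q v = 3 → ∃ c : Fin 5 → α, c 0 = a ∧ Function.Injective c ∧
      ∀ x y, x ≠ y → w (c x) (c y) = if x - y = 1 ∨ y - x = 1 then 3 else -3 := by
    intro u v huv hpu hpv hqu hqv hua hva e1 e2 e3 e4 e5 e6 e7 e8
    have key : ∀ x y : Fin 5, x < y → (![a, p, u, v, q] x) ≠ (![a, p, u, v, q] y) ∧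
        w (![a, p, u, v, q] x) (![a, p, u, v, q] y) = if x - y = 1 ∨ y - x = 1 then 3 else -3 := by
      intro x y hxy
      fin_cases x <;> fin_cases y <;> first | exact absurd hxy (by decide) | skip
      · exact ⟨hpa.symm, mp⟩
      · exact ⟨hua.symm, e1⟩
      · exact ⟨hva.symm, e2⟩
      · exact ⟨hqa.symm, mq⟩
      · exact ⟨hpu, e5⟩
      · exact ⟨hpv, e6⟩
      · exact ⟨hpq, e3⟩
      · exact ⟨huv, e4⟩
      · exact ⟨hqu.symm, (h.symm u q).trans e7⟩
      · exact ⟨hqv.symm, (h.symm v q).trans e8⟩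
    refine ⟨![a, p, u, v, q], rfl, ?_, ?_⟩
    · intro x y hxy
      by_contra hne
      rcases lt_or_gt_of_ne hne with hlt | hlt
      · exact (key x y hlt).1 hxy
      · exact (key y x hlt).1 hxy.symm
    · intro x y hxy
      rcases lt_or_gt_of_ne hxy with hlt | hlt
      · exact (key x y hlt).2
      · rw [h.symm, (key y x hlt).2]
        simp only [or_comm]
  have hpr' := mixed p r hpa hra hpr mp mr
  have hps' := mixed p s hpa hsa hps mp ms
  have hqr' := mixed q r hqa hra hqr mq mr
  have hqs' := mixed q s hqa hsa hqs mq ms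
  have hra' := (h.symm r a).trans mr
  have hsa' := (h.symm s a).trans ms
  rcases hpr' with e | e
  · have e1 := hps'.resolve_left
      (third (Or.inl rfl) hpa hpr hps hra.symm hsa.symm hrs ((h.symm p a).trans mp) e)
    have e2 := hqr'.resolve_left fun e2 => third (Or.inl rfl) hpr.symm hqr.symm hrs hpq hps hqs
      ((h.symm r p).trans e) ((h.symm r q).trans e2) hrs'
    have e3 := hqs'.resolve_right fun e3 => third (Or.inr rfl) hsa hps.symm hqs.symm hpa.symm
      hqa.symm hpq hsa' ((h.symm s p).trans e1) ((h.symm s q).trans e3)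
    exact build r s hrs hpr hps hqr hqs hra hsa mr ms hpq' hrs' e e1 e2 e3
  · have e1 := hps'.resolve_right (third (Or.inr rfl) hpq hpr hps hqr hqs hrs hpq' e)
    have e2 := hqr'.resolve_right fun e2 => third (Or.inr rfl) hra hpr.symm hqr.symm hpa.symm
      hqa.symm hpq hra' ((h.symm r p).trans e) ((h.symm r q).trans e2)
    have e3 := hqs'.resolve_left
      (third (Or.inl rfl) hqa hqr hqs hra.symm hsa.symm hrs ((h.symm q a).trans mq) e2)
    exact build s r hrs.symm hps hpr hqs hqr hsa hra ms mr hpq' ((h.symm s r).trans hrs') e1 e e3 e2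

theorem exists_pentagon_labelling (h : IsBalancedWeight w) (hα : Fintype.card α = 10)
    (hv : ∀ a b, a ≠ b → w a b = 3 ∨ w a b = -3 ∨ w a b = 0) :
    ∃ e : Fin 2 × Fin 5 → α, Function.Injective e ∧
      ∀ p q, p ≠ q → w (e p) (e q) = pentagonWeight p q := by
  have : 0 < Fintype.card α := by omega
  obtain ⟨a⟩ := Fintype.card_pos_iff.1 this
  obtain ⟨z, hz⟩ : (fiber w a 0).Nonempty := by
    rw [← Finset.card_pos, (h.card_fibers_of_zero hα hv a).2.2]; norm_num
  rw [mem_fiber] at hz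
  obtain ⟨c, hc0, hc, hcw⟩ := h.exists_pentagon hα hv a
  obtain ⟨d, hd0, hd, hdw⟩ := h.exists_pentagon hα hv z
  have hcn : ∀ x y, x ≠ y → w (c x) (c y) ≠ 0 := by
    intro x y hxy; rw [hcw x y hxy]; split_ifs <;> norm_num
  have hdn : ∀ x y, x ≠ y → w (d x) (d y) ≠ 0 := by
    intro x y hxy; rw [hdw x y hxy]; split_ifs <;> norm_num
  -- `z` lies outside the first pentagon and is joined to it with weight zero
  have hz1 : ∀ x, z ≠ c x ∧ w z (c x) = 0 := by
    intro x
    by_cases hx : x = 0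
    · subst hx; rw [hc0, h.symm]; exact hz
    · have h1 := hcn 0 x (Ne.symm hx)
      rw [hc0] at h1
      have hzx : z ≠ c x := by rintro rfl; exact h1 hz.2
      have hax : a ≠ c x := by rw [← hc0]; exact fun he => hx (hc he).symm
      exact ⟨hzx, h.eq_zero_of_ne_zero hv hz.1 hax hzx (by rw [h.symm]; exact hz.2) h1⟩
  have hcd : ∀ x y, c x ≠ d y ∧ w (c x) (d y) = 0 := by
    intro x y
    obtain ⟨h1, h2⟩ := hz1 x
    by_cases hy : y = 0
    · subst hy; rw [hd0, h.symm]; exact ⟨h1.symm, h2⟩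
    · have h3 := hdn 0 y (Ne.symm hy)
      rw [hd0] at h3
      have hne : c x ≠ d y := by intro he; rw [← he] at h3; exact h3 h2
      have hzy : z ≠ d y := by rw [← hd0]; exact fun he => hy (hd he).symm
      exact ⟨hne, h.eq_zero_of_ne_zero hv h1.symm hzy hne (by rw [h.symm]; exact h2) h3⟩
  refine ⟨fun p => if p.1 = 0 then c p.2 else d p.2, ?_, ?_⟩
  · rintro ⟨i, x⟩ ⟨j, y⟩ he
    fin_cases i <;> fin_cases j
    · simpa using hc (by simpa using he)
    · exact absurd (by simpa using he) (hcd x y).1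
    · exact absurd (by simpa using he) (hcd y x).1.symm
    · simpa using hd (by simpa using he)
  · rintro ⟨i, x⟩ ⟨j, y⟩ hne
    fin_cases i <;> fin_cases j
    · simpa [pentagonWeight] using hcw x y (by rintro rfl; exact hne rfl)
    · simpa [pentagonWeight] using (hcd x y).2
    · simpa [pentagonWeight] using (h.symm _ _).trans (hcd y x).2
    · simpa [pentagonWeight] using hdw x y (by rintro rfl; exact hne rfl)

/-! ### Weights congruent to one modulo three -/

/-- Being equal or joined with weight `1` is an equivalence relation. -/
theorem eq_one_of_eq_one (h : IsBalancedWeight w)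
    (hv : ∀ a b, a ≠ b → w a b = 4 ∨ w a b = 1 ∨ w a b = -2) {a b c : α} (hab : a ≠ b)
    (hbc : b ≠ c) (hac : a ≠ c) (h1 : w a b = 1) (h2 : w b c = 1) : w a c = 1 := by
  have := h.triangle a b c hab hbc hac
  have := hv a c hac
  omega

theorem card_fiber_four_le_one (h : IsBalancedWeight w)
    (hv : ∀ a b, a ≠ b → w a b = 4 ∨ w a b = 1 ∨ w a b = -2) (a : α) :
    (fiber w a 4).card ≤ 1 := by
  by_contra! hc
  obtain ⟨x, hx, y, hy, hxy⟩ := Finset.one_lt_card.1 hc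
  rw [mem_fiber] at hx hy
  have := h.triangle a x y hx.1.symm hxy hy.1.symm
  have := hv x y hxy
  omega

/-- Weight `4` occurs at most once at `a`. If it did not occur, the row sum would force seven points
into the class of `a` under "weight one", and the class of an outside point has at least five
more. -/
theorem card_fibers_of_one (h : IsBalancedWeight w) (hα : Fintype.card α = 10)
    (hv : ∀ a b, a ≠ b → w a b = 4 ∨ w a b = 1 ∨ w a b = -2) (a : α) :
    (fiber w a 4).card = 1 ∧ (fiber w a 1).card = 4 := by
  have hf := fun v => h.card_fibers v (i := 4) (j := 1) (k := -2) (by norm_num) (by norm_num)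
    (by norm_num) (fun b hb => hv v b hb.symm)
  have h4 := h.card_fiber_four_le_one hv
  have ha := hf a
  have ha4 := h4 a
  suffices (fiber w a 4).card ≠ 0 by omega
  intro h0
  obtain ⟨b, hb⟩ : (fiber w a (-2)).Nonempty := by
    rw [← Finset.card_pos]; omega
  rw [mem_fiber] at hb
  have hd : Disjoint (fiber w a 1) (fiber w b 1) := by
    rw [Finset.disjoint_left]
    intro x hx hx'
    rw [mem_fiber] at hx hx'
    have := h.eq_one_of_eq_one hv hx.1.symm hx'.1 hb.1.symm hx.2 (by rw [h.symm]; exact hx'.2)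
    omega
  have ha' : a ∉ fiber w a 1 ∪ fiber w b 1 := by
    have := h.symm a b
    simp only [Finset.mem_union, mem_fiber]
    rintro (h1 | h1)
    · exact h1.1 rfl
    · omega
  have hle := Finset.card_le_univ (insert a (fiber w a 1 ∪ fiber w b 1))
  rw [Finset.card_insert_of_notMem ha', Finset.card_union_of_disjoint hd] at hle
  have hb' := hf b
  have hb4 := h4 b
  omega

theorem exists_matching_labelling (h : IsBalancedWeight w) (hα : Fintype.card α = 10)
    (hv : ∀ a b, a ≠ b → w a b = 4 ∨ w a b = 1 ∨ w a b = -2) :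
    ∃ e : Fin 2 × Fin 5 → α, Function.Injective e ∧
      ∀ p q, p ≠ q → w (e p) (e q) = matchingWeight p q := by
  have : 0 < Fintype.card α := by omega
  obtain ⟨a⟩ := Fintype.card_pos_iff.1 this
  have hcard : (insert a (fiber w a 1)).card = 5 := by
    rw [Finset.card_insert_of_notMem (by simp [mem_fiber]), (h.card_fibers_of_one hα hv a).2]
  let c := Finset.equivFinOfCardEq hcard
  obtain ⟨f, hf, hmem⟩ : ∃ f : Fin 5 → α, Function.Injective f ∧
      ∀ x, f x = a ∨ f x ≠ a ∧ w a (f x) = 1 := by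
    refine ⟨fun x => c.symm x, Subtype.val_injective.comp c.symm.injective, fun x => ?_⟩
    have := (c.symm x).2
    rwa [Finset.mem_insert, mem_fiber] at this
  have hff : ∀ x y, x ≠ y → w (f x) (f y) = 1 := by
    intro x y hxy
    have hne := hf.ne hxy
    rcases hmem x with hx | ⟨hx, hx1⟩ <;> rcases hmem y with hy | ⟨hy, hy1⟩
    · exact absurd (hx.trans hy.symm) hne
    · rw [hx]; exact hy1
    · rw [hy, h.symm]; exact hx1
    · exact h.eq_one_of_eq_one hv hx hy.symm hne (by rw [h.symm]; exact hx1) hy1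
  -- the partner of each point under the matching of weight `4`
  have hg : ∀ x, ∃ b, b ≠ f x ∧ w (f x) b = 4 := by
    intro x
    obtain ⟨b, hb⟩ := Finset.card_pos.1
      (by rw [(h.card_fibers_of_one hα hv (f x)).1]; norm_num : 0 < (fiber w (f x) 4).card)
    exact ⟨b, mem_fiber.1 hb⟩
  choose g hg1 hg2 using hg
  have hfg : ∀ x y, f x ≠ g y := by
    intro x y he
    by_cases hxy : x = y
    · subst hxy; exact hg1 x he.symm
    · have h1 := hff y x (Ne.symm hxy)
      have h2 := hg2 y
      rw [he] at h1
      omega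
  have hfgw : ∀ x y, x ≠ y → w (f x) (g y) = -2 := by
    intro x y hxy
    have := h.triangle (f x) (f y) (g y) (hf.ne hxy) (hfg y y) (hfg x y)
    have := hff x y hxy
    have := hg2 y
    have := hv (f x) (g y) (hfg x y)
    omega
  have hginj : Function.Injective g := by
    intro x y he
    by_contra hxy
    have h1 := hfgw x y hxy
    rw [← he, hg2 x] at h1
    norm_num at h1
  have hgg : ∀ x y, x ≠ y → w (g x) (g y) = 1 := by
    intro x y hxy
    have hne := hginj.ne hxy
    have := h.triangle (f x) (g x) (g y) (hfg x x) hne (hfg x y)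
    have := hfgw x y hxy
    have := hg2 x
    have := hv (g x) (g y) hne
    omega
  refine ⟨fun p => if p.1 = 0 then f p.2 else g p.2, ?_, ?_⟩
  · rintro ⟨i, x⟩ ⟨j, y⟩ he
    fin_cases i <;> fin_cases j
    · simpa using hf (by simpa using he)
    · exact absurd (by simpa using he) (hfg x y)
    · exact absurd (by simpa using he) (hfg y x).symm
    · simpa using hginj (by simpa using he)
  · have hmix : ∀ x y, w (f x) (g y) = if x = y then 4 else -2 := by
      intro x y
      split_ifs with hxy
      · subst hxy; exact hg2 x
      · exact hfgw x y hxy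
    rintro ⟨i, x⟩ ⟨j, y⟩ hne
    fin_cases i <;> fin_cases j
    · simpa [matchingWeight] using hff x y (by rintro rfl; exact hne rfl)
    · simpa [matchingWeight] using hmix x y
    · simpa [matchingWeight, eq_comm] using (h.symm _ _).trans (hmix y x)
    · simpa [matchingWeight] using hgg x y (by rintro rfl; exact hne rfl)

end IsBalancedWeight

/-! ### Pair degrees in the Johnson graph of triples -/

/-- The number of triples of `S` that contain both `a` and `b`. -/
def pairDegree {n : ℕ} (S : Finset (JohnsonVertex n 3)) (a b : Fin n) : ℕ :=
  (S.filter (fun s => a ∈ s.1 ∧ b ∈ s.1)).card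

/-- The set `{a, b, c}` belongs to `S`. -/
def HasTriple {n : ℕ} (S : Finset (JohnsonVertex n 3)) (a b c : Fin n) : Prop :=
  ({a, b, c} : Finset (Fin n)) ∈ S.map (Function.Embedding.subtype _)

instance {n : ℕ} (S : Finset (JohnsonVertex n 3)) (a b c : Fin n) : Decidable (HasTriple S a b c) :=
  inferInstanceAs (Decidable (_ ∈ _))

theorem pairDegree_comm {n : ℕ} (S : Finset (JohnsonVertex n 3)) (a b : Fin n) :
    pairDegree S a b = pairDegree S b a := by
  simp only [pairDegree, and_comm]

theorem JohnsonVertex.exists_eq {n : ℕ} (x : JohnsonVertex n 3) :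
    ∃ a b c, a ≠ b ∧ b ≠ c ∧ a ≠ c ∧ x.1 = {a, b, c} := by
  obtain ⟨a, b, c, hab, hac, hbc, h⟩ := Finset.card_eq_three.1 x.2
  exact ⟨a, b, c, hab, hbc, hac, h⟩

theorem hasTriple_iff {n : ℕ} {S : Finset (JohnsonVertex n 3)} {x : JohnsonVertex n 3}
    {a b c : Fin n} (hx : x.1 = {a, b, c}) : HasTriple S a b c ↔ x ∈ S := by
  rw [HasTriple, ← hx]
  exact Finset.mem_map' (Function.Embedding.subtype _)

theorem johnsonGraph_adj_iff {n : ℕ} {x s : JohnsonVertex n 3} :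
    (johnsonGraph n 3).Adj x s ↔ (x.1 ∩ s.1).card = 2 := by
  change (x.1 ∩ s.1).card + 1 = 3 ↔ _
  omega

/-- A triple meeting `{a, b, c}` in two points contains one of the pairs `ab`, `bc`, `ac`, and
`{a, b, c}` itself contains all three. -/
theorem pairDegree_add_add {n : ℕ} (S : Finset (JohnsonVertex n 3)) {x : JohnsonVertex n 3}
    {a b c : Fin n} (hab : a ≠ b) (hbc : b ≠ c) (hac : a ≠ c) (hx : x.1 = {a, b, c}) :
    pairDegree S a b + pairDegree S b c + pairDegree S a c =
      (if x ∈ S then 3 else 0) + ((johnsonGraph n 3).neighborFinset x ∩ S).card := by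
  have h1 : (if x ∈ S then 3 else 0) = ∑ s ∈ S, if x = s then 3 else 0 := by
    rw [Finset.sum_ite_eq]
  have h2 : (johnsonGraph n 3).neighborFinset x ∩ S =
      S.filter (fun s => (johnsonGraph n 3).Adj x s) := by
    ext s; simp [and_comm]
  rw [h1, h2]
  simp only [pairDegree, Finset.card_filter]
  rw [← Finset.sum_add_distrib, ← Finset.sum_add_distrib, ← Finset.sum_add_distrib]
  refine Finset.sum_congr rfl fun s _ => ?_
  have hc : (x.1 ∩ s.1).card =
      (if a ∈ s.1 then 1 else 0) + ((if b ∈ s.1 then 1 else 0) + (if c ∈ s.1 then 1 else 0)) := by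
    rw [← Finset.filter_mem_eq_inter, hx, Finset.card_filter,
      Finset.sum_insert (by simp [hab, hac]), Finset.sum_pair hbc]
  have he : x = s ↔ (x.1 ∩ s.1).card = 3 := by
    constructor
    · rintro rfl; rw [Finset.inter_self]; exact x.2
    · intro h
      have e1 := Finset.eq_of_subset_of_card_le Finset.inter_subset_left (by rw [x.2, h])
      have e2 := Finset.eq_of_subset_of_card_le Finset.inter_subset_right (by rw [s.2, h])
      exact Subtype.ext (e1.symm.trans e2)
  have hadj := johnsonGraph_adj_iff (x := x) (s := s)
  generalize x.1 ∩ s.1 = u at hc he hadj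
  by_cases ha : a ∈ s.1 <;> by_cases hb : b ∈ s.1 <;> by_cases hc' : c ∈ s.1 <;>
    simp only [ha, hb, hc', if_true, if_false] at hc <;>
    simp [ha, hb, hc', he, hadj, hc]

theorem pairDegree_eq_card {n : ℕ} (S : Finset (JohnsonVertex n 3)) {a b : Fin n} (hab : a ≠ b) :
    pairDegree S a b =
      (((Finset.univ.erase a).erase b).filter (fun c => HasTriple S a b c)).card := by
  symm
  have hmem : ∀ c, c ∈ ((Finset.univ.erase a).erase b).filter (fun c => HasTriple S a b c) ↔
      (c ≠ b ∧ c ≠ a) ∧ HasTriple S a b c := by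
    intro c; simp
  have hcard : ∀ c, c ≠ b ∧ c ≠ a → ({a, b, c} : Finset (Fin n)).card = 3 := fun c hc =>
    Finset.card_eq_three.2 ⟨a, b, c, hab, hc.2.symm, hc.1.symm, rfl⟩
  refine Finset.card_bij (fun c hc => ⟨{a, b, c}, hcard c ((hmem c).1 hc).1⟩) ?_ ?_ ?_
  · intro c hc
    have h1 := (hmem c).1 hc
    rw [Finset.mem_filter]
    exact ⟨(hasTriple_iff rfl).1 h1.2, by simp, by simp⟩
  · intro c hc d hd he
    have h1 := ((hmem c).1 hc).1
    have h2 : c ∈ ({a, b, d} : Finset (Fin n)) := by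
      rw [← Subtype.mk.inj he]; simp
    simpa [h1.1, h1.2] using h2
  · intro s hs
    rw [Finset.mem_filter] at hs
    obtain ⟨hsS, has, hbs⟩ := hs
    obtain ⟨c, hc⟩ : ∃ c, c ∈ s.1 \ {a, b} := by
      rw [← Finset.Nonempty, ← Finset.card_pos]
      have := Finset.le_card_sdiff {a, b} s.1
      rw [s.2, Finset.card_pair hab] at this
      omega
    simp only [Finset.mem_sdiff, Finset.mem_insert, Finset.mem_singleton, not_or] at hc
    have hs : {a, b, c} = s.1 := by
      refine Finset.eq_of_subset_of_card_le ?_ (by rw [s.2, hcard c ⟨hc.2.2, hc.2.1⟩])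
      simp [Finset.insert_subset_iff, has, hbs, hc.1]
    exact ⟨c, (hmem c).2 ⟨⟨hc.2.2, hc.2.1⟩, (hasTriple_iff hs.symm).2 hsS⟩, Subtype.ext hs⟩

/-- The local condition on a set of triples of a ten-point set that makes it a part of a perfect
coloring with quotient matrix `[12, 9; 9, 12]`, in terms of pair degrees. -/
def IsHalf (S : Finset (JohnsonVertex 10 3)) : Prop :=
  ∀ a b c, a ≠ b → b ≠ c → a ≠ c →
    pairDegree S a b + pairDegree S b c + pairDegree S a c = if HasTriple S a b c then 15 else 9

theorem pairDegree_univ {a b : Fin 10} (hab : a ≠ b) : pairDegree Finset.univ a b = 8 := by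
  rw [pairDegree_eq_card _ hab, Finset.filter_true_of_mem, Finset.card_erase_of_mem,
    Finset.card_erase_of_mem (Finset.mem_univ _), Finset.card_univ, Fintype.card_fin]
  · simpa using hab.symm
  · intro c hc
    simp only [Finset.mem_erase, Finset.mem_univ, and_true] at hc
    exact (hasTriple_iff (x := ⟨{a, b, c}, Finset.card_eq_three.2
      ⟨a, b, c, hab, hc.2.symm, hc.1.symm, rfl⟩⟩) rfl).2 (Finset.mem_univ _)

theorem card_neighborFinset (x : JohnsonVertex 10 3) :
    ((johnsonGraph 10 3).neighborFinset x).card = 21 := by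
  obtain ⟨a, b, c, hab, hbc, hac, hx⟩ := x.exists_eq
  have h := pairDegree_add_add Finset.univ hab hbc hac hx
  rw [pairDegree_univ hab, pairDegree_univ hbc, pairDegree_univ hac, Finset.inter_univ] at h
  simp only [Finset.mem_univ, if_true] at h
  omega

theorem pairDegree_le {S : Finset (JohnsonVertex 10 3)} {a b : Fin 10} (hab : a ≠ b) :
    pairDegree S a b ≤ 8 := by
  rw [← pairDegree_univ hab]
  exact Finset.card_le_card (Finset.filter_subset_filter _ (Finset.subset_univ S))

theorem pairDegree_compl (S : Finset (JohnsonVertex 10 3)) {a b : Fin 10} (hab : a ≠ b) :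
    pairDegree S a b + pairDegree Sᶜ a b = 8 := by
  rw [← pairDegree_univ hab, pairDegree, pairDegree, pairDegree, ← Finset.card_union_of_disjoint
    (Finset.disjoint_filter_filter disjoint_compl_right), ← Finset.filter_union,
    Finset.union_compl]

theorem card_neighborFinset_inter_compl (S : Finset (JohnsonVertex 10 3)) (x : JohnsonVertex 10 3) :
    ((johnsonGraph 10 3).neighborFinset x ∩ S).card +
      ((johnsonGraph 10 3).neighborFinset x ∩ Sᶜ).card = 21 := by
  rw [← card_neighborFinset x, ← Finset.card_union_of_disjoint, ← Finset.inter_union_distrib_left,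
    Finset.union_compl, Finset.inter_univ]
  exact disjoint_compl_right.mono Finset.inter_subset_right Finset.inter_subset_right

theorem IsPerfectColoring.compl_eq {V : Type*} [Fintype V] [DecidableEq V] {G : SimpleGraph V}
    [DecidableRel G.Adj] {P : Fin 2 → Finset V} {M : Matrix (Fin 2) (Fin 2) ℕ}
    (h : IsPerfectColoring G P M) : (P 0)ᶜ = P 1 := by
  ext x
  have h1 := h.disjoint 0 1 (by decide)
  have h2 := h.cover x
  rw [Fin.exists_fin_two] at h2
  rw [Finset.mem_compl]
  exact ⟨fun h3 => h2.resolve_left h3, fun h3 h4 => Finset.disjoint_left.1 h1 h4 h3⟩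

theorem IsPerfectColoring.isHalf {X : Fin 2 → Finset (JohnsonVertex 10 3)}
    (h : IsPerfectColoring (johnsonGraph 10 3) X quotientMatrix) (i : Fin 2) : IsHalf (X i) := by
  intro a b c hab hbc hac
  set x : JohnsonVertex 10 3 := ⟨{a, b, c}, Finset.card_eq_three.2 ⟨a, b, c, hab, hac, hbc, rfl⟩⟩
    with hx
  rw [pairDegree_add_add (X i) (x := x) hab hbc hac rfl]
  simp only [hasTriple_iff (S := X i) (x := x) rfl]
  obtain ⟨j, hj⟩ := h.cover x
  rw [h.count j i x hj]
  by_cases hij : i = j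
  · subst hij
    rw [if_pos hj, if_pos hj]
    fin_cases i <;> rfl
  · have hxi : x ∉ X i := fun hxi => Finset.disjoint_left.1 (h.disjoint i j hij) hxi hj
    rw [if_neg hxi, if_neg hxi]
    fin_cases i <;> fin_cases j <;> first | rfl | exact absurd rfl hij

theorem IsHalf.isPerfectColoring {X : Fin 2 → Finset (JohnsonVertex 10 3)} (h : IsHalf (X 0))
    (hc : X 1 = (X 0)ᶜ) (hn : ∀ i, (X i).Nonempty) :
    IsPerfectColoring (johnsonGraph 10 3) X quotientMatrix where
  nonempty := hn
  disjoint := by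
    intro i j hij
    fin_cases i <;> fin_cases j
    · exact absurd rfl hij
    · simpa [hc] using disjoint_compl_right
    · simpa [hc] using disjoint_compl_left
    · exact absurd rfl hij
  cover := by
    intro x
    rw [Fin.exists_fin_two, hc, Finset.mem_compl]
    exact em _
  count := by
    intro i j x hx
    obtain ⟨a, b, c, hab, hbc, hac, hxe⟩ := x.exists_eq
    have h1 := pairDegree_add_add (X 0) hab hbc hac hxe
    rw [h a b c hab hbc hac] at h1
    simp only [hasTriple_iff hxe] at h1
    have h2 := card_neighborFinset_inter_compl (X 0) x
    rw [← hc] at h2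
    have h3 : x ∈ X 1 ↔ x ∉ X 0 := by rw [hc, Finset.mem_compl]
    by_cases hx0 : x ∈ X 0
    · rw [if_pos hx0, if_pos hx0] at h1
      have hx1 : x ∉ X 1 := by tauto
      fin_cases i <;> fin_cases j <;> simp [quotientMatrix] <;> first | omega | exact absurd hx hx1
    · rw [if_neg hx0, if_neg hx0] at h1
      fin_cases i <;> fin_cases j <;> simp [quotientMatrix] <;> first | omega | exact absurd hx hx0

/-- The pair degrees, centered at `4`, the mean for a half; passing to the complement of `S` changes
the sign. -/
def centeredDegree (S : Finset (JohnsonVertex 10 3)) (a b : Fin 10) : ℤ :=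
  (pairDegree S a b : ℤ) - 4

/-- Summing the triangle relation over all third points `c` shows that the row sums at any two
points are opposite; with three points they vanish. -/
theorem IsHalf.isBalancedWeight {S : Finset (JohnsonVertex 10 3)} (h : IsHalf S) :
    IsBalancedWeight (centeredDegree S) where
  symm a b := by rw [centeredDegree, centeredDegree, pairDegree_comm]
  triangle a b c hab hbc hac := by
    have := h a b c hab hbc hac
    simp only [centeredDegree]
    split_ifs at this <;> omega
  row := by
    set R : Fin 10 → ℤ := fun a => ∑ b ∈ Finset.univ.erase a, centeredDegree S a b with hR
    have key : ∀ a b, a ≠ b → R a + R b = 0 := by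
      intro a b hab
      have hba : b ∈ (Finset.univ : Finset (Fin 10)).erase a := by simp [hab.symm]
      have hab' : a ∈ (Finset.univ : Finset (Fin 10)).erase b := by simp [hab]
      have hcard : (((Finset.univ : Finset (Fin 10)).erase a).erase b).card = 8 := by
        rw [Finset.card_erase_of_mem hba, Finset.card_erase_of_mem (Finset.mem_univ _)]; rfl
      have e1 : R a = ∑ c ∈ (Finset.univ.erase a).erase b, centeredDegree S a c +
          centeredDegree S a b := (Finset.sum_erase_add _ _ hba).symm
      have e2 : R b = ∑ c ∈ (Finset.univ.erase a).erase b, centeredDegree S b c +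
          centeredDegree S b a := by
        rw [Finset.erase_right_comm]; exact (Finset.sum_erase_add _ _ hab').symm
      have e3 : ∑ c ∈ (Finset.univ.erase a).erase b,
          (centeredDegree S a b + centeredDegree S b c + centeredDegree S a c) =
          ∑ c ∈ (Finset.univ.erase a).erase b, ((if HasTriple S a b c then 6 else 0) - 3) := by
        refine Finset.sum_congr rfl fun c hc => ?_
        simp only [Finset.mem_erase, Finset.mem_univ, and_true] at hc
        have := h a b c hab hc.1.symm hc.2.symm
        simp only [centeredDegree]
        split_ifs at this ⊢ <;> omega
      have e4 : ∑ c ∈ (Finset.univ.erase a).erase b, (if HasTriple S a b c then (6 : ℤ) else 0) =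
          6 * pairDegree S a b := by
        rw [pairDegree_eq_card S hab, ← Finset.sum_filter, Finset.sum_const, nsmul_eq_mul, mul_comm]
      rw [Finset.sum_add_distrib, Finset.sum_add_distrib, Finset.sum_sub_distrib, e4,
        Finset.sum_const, Finset.sum_const, hcard] at e3
      have e5 : centeredDegree S b a = centeredDegree S a b := by
        rw [centeredDegree, centeredDegree, pairDegree_comm]
      have e6 : centeredDegree S a b = pairDegree S a b - 4 := rfl
      simp only [nsmul_eq_mul, Nat.cast_ofNat] at e3
      linarith
    intro a
    obtain ⟨b, hb⟩ : ∃ b, b ≠ a := exists_ne a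
    obtain ⟨c, hc⟩ : ∃ c, c ∉ ({a, b} : Finset (Fin 10)) := by
      by_contra! hall
      have h1 : (Finset.univ : Finset (Fin 10)).card ≤ ({a, b} : Finset (Fin 10)).card :=
        Finset.card_le_card fun c _ => hall c
      have := (Finset.card_le_two : ({a, b} : Finset (Fin 10)).card ≤ 2)
      rw [Finset.card_univ, Fintype.card_fin] at h1
      omega
    simp only [Finset.mem_insert, Finset.mem_singleton, not_or] at hc
    have h1 := key a b hb.symm
    have h2 := key a c (Ne.symm hc.1)
    have h3 := key b c (Ne.symm hc.2)
    change R a = 0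
    linarith

/-! ### Labellings and isomorphisms -/

/-- A labelling of the ten points under which the centered degrees of `S` become the weight `m`. -/
def HasLabelling (S : Finset (JohnsonVertex 10 3)) (m : Fin 2 × Fin 5 → Fin 2 × Fin 5 → ℤ) : Prop :=
  ∃ e : Fin 2 × Fin 5 → Fin 10, Function.Injective e ∧
    ∀ p q, p ≠ q → centeredDegree S (e p) (e q) = m p q

theorem IsHalf.hasLabelling_pentagonWeight {S : Finset (JohnsonVertex 10 3)} (h : IsHalf S)
    (ht : IsOfType S 1) : HasLabelling S pentagonWeight := by
  refine h.isBalancedWeight.exists_pentagon_labelling (Fintype.card_fin 10) fun a b hab => ?_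
  have h1 := pairDegree_le (S := S) hab
  have h2 : pairDegree S a b % 3 = 1 := ht a b hab
  simp only [centeredDegree]
  omega

theorem IsHalf.hasLabelling_matchingWeight {S : Finset (JohnsonVertex 10 3)} (h : IsHalf S)
    (ht : IsOfType S 2) : HasLabelling S matchingWeight := by
  refine h.isBalancedWeight.exists_matching_labelling (Fintype.card_fin 10) fun a b hab => ?_
  have h1 := pairDegree_le (S := S) hab
  have h2 : pairDegree S a b % 3 = 2 := ht a b hab
  simp only [centeredDegree]
  omega

theorem IsHalf.exists_isOfType {S : Finset (JohnsonVertex 10 3)} (h : IsHalf S) :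
    ∃ t, IsOfType S t := by
  obtain ⟨t, ht⟩ := h.isBalancedWeight.exists_emod_eq (by rw [Fintype.card_fin]; norm_num)
  have h0 := ht 0 1 (by decide)
  refine ⟨⟨((t + 1) % 3).toNat, by omega⟩, fun a b hab => ?_⟩
  have := ht a b hab
  change pairDegree S a b % 3 = ((t + 1) % 3).toNat
  simp only [centeredDegree] at this
  omega

theorem IsOfType.compl {S : Finset (JohnsonVertex 10 3)} {t u : Fin 3} (h : IsOfType S t)
    (htu : (t.val + u.val) % 3 = 2) : IsOfType Sᶜ u := by
  intro a b hab
  have h1 : pairDegree S a b % 3 = t.val := h a b hab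
  have h2 := pairDegree_compl S hab
  change pairDegree Sᶜ a b % 3 = u.val
  omega

/-- The automorphism of `J(n, k)` induced by a permutation of the points. -/
def johnsonGraphIso (n k : ℕ) (σ : Equiv.Perm (Fin n)) : johnsonGraph n k ≃g johnsonGraph n k where
  toEquiv :=
    { toFun := fun s => ⟨s.1.map σ.toEmbedding, by rw [Finset.card_map, s.2]⟩
      invFun := fun s => ⟨s.1.map σ.symm.toEmbedding, by rw [Finset.card_map, s.2]⟩
      left_inv := fun s => Subtype.ext (by ext; simp)
      right_inv := fun s => Subtype.ext (by ext; simp) }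
  map_rel_iff' := by
    intro s t
    change (s.1.map σ.toEmbedding ∩ t.1.map σ.toEmbedding).card + 1 = k ↔ (s.1 ∩ t.1).card + 1 = k
    rw [← Finset.map_inter, Finset.card_map]

/-- A half is recovered from its pair degrees, so two halves with the same labelled weight are
mapped onto each other by a permutation of the points. -/
theorem IsHalf.exists_iso {S T : Finset (JohnsonVertex 10 3)} (hS : IsHalf S) (hT : IsHalf T)
    {m : Fin 2 × Fin 5 → Fin 2 × Fin 5 → ℤ} (hSm : HasLabelling S m) (hTm : HasLabelling T m) :
    ∃ φ : johnsonGraph 10 3 ≃g johnsonGraph 10 3, ∀ x, x ∈ S ↔ φ x ∈ T := by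
  obtain ⟨e, he, hem⟩ := hSm
  obtain ⟨f, hf, hfm⟩ := hTm
  have hcard : Fintype.card (Fin 2 × Fin 5) = Fintype.card (Fin 10) := by simp
  let E := Equiv.ofBijective e ((Fintype.bijective_iff_injective_and_card e).2 ⟨he, hcard⟩)
  let F := Equiv.ofBijective f ((Fintype.bijective_iff_injective_and_card f).2 ⟨hf, hcard⟩)
  let σ : Equiv.Perm (Fin 10) := E.symm.trans F
  have hσ : ∀ a b, a ≠ b → pairDegree S a b = pairDegree T (σ a) (σ b) := by
    intro a b hab
    have hne : E.symm a ≠ E.symm b := E.symm.injective.ne hab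
    have h1 := hem _ _ hne
    rw [← hfm _ _ hne] at h1
    have e1 : ∀ a, e (E.symm a) = a := fun a => E.apply_symm_apply a
    rw [e1, e1] at h1
    have h2 : centeredDegree S a b = centeredDegree T (σ a) (σ b) := h1
    simp only [centeredDegree] at h2
    omega
  refine ⟨johnsonGraphIso 10 3 σ, fun x => ?_⟩
  obtain ⟨a, b, c, hab, hbc, hac, hx⟩ := x.exists_eq
  have hx' : (johnsonGraphIso 10 3 σ x).1 = {σ a, σ b, σ c} := by
    change x.1.map σ.toEmbedding = _
    rw [hx]; simp
  have h1 := hS a b c hab hbc hac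
  have h2 := hT (σ a) (σ b) (σ c) (σ.injective.ne hab) (σ.injective.ne hbc) (σ.injective.ne hac)
  rw [← hσ a b hab, ← hσ b c hbc, ← hσ a c hac, h1] at h2
  rw [← hasTriple_iff hx, ← hasTriple_iff hx']
  split_ifs at h2 <;> simp_all

theorem coloringIso_of_iso {V : Type*} [Fintype V] [DecidableEq V] {G : SimpleGraph V}
    {X Y : Fin 2 → Finset V} (hX : (X 0)ᶜ = X 1) (hY : (Y 0)ᶜ = Y 1) {i j : Fin 2} (φ : G ≃g G)
    (h : ∀ x, x ∈ X i ↔ φ x ∈ Y j) : ColoringIso G X Y := by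
  have hX' : ∀ x, x ∈ X 1 ↔ x ∉ X 0 := fun x => by rw [← hX, Finset.mem_compl]
  have hY' : ∀ x, x ∈ Y 1 ↔ x ∉ Y 0 := fun x => by rw [← hY, Finset.mem_compl]
  refine ⟨φ, Equiv.swap i j, fun k x => ?_⟩
  have := h x
  have := hX' x
  have := hY' (φ x)
  fin_cases i <;> fin_cases j <;> fin_cases k <;> simp at * <;> tauto

/-! ### The two colorings on the ten-cycle -/

theorem cycleDist_comm (a b : Fin 10) : cycleDist a b = cycleDist b a :=
  min_comm _ _

theorem multiset_triple_eq_iff {u v w p q r : ℕ} : ({u, v, w} : Multiset ℕ) = {p, q, r} ↔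
    (u = p ∧ v = q ∧ w = r) ∨ (u = p ∧ v = r ∧ w = q) ∨ (u = q ∧ v = p ∧ w = r) ∨
      (u = q ∧ v = r ∧ w = p) ∨ (u = r ∧ v = p ∧ w = q) ∨ (u = r ∧ v = q ∧ w = p) := by
  constructor
  · intro h
    have hu := congrArg (Multiset.count u) h
    have hv := congrArg (Multiset.count v) h
    have hw := congrArg (Multiset.count w) h
    simp only [Multiset.insert_eq_cons, Multiset.count_cons, Multiset.count_singleton] at hu hv hw
    grind
  · have m1 : ∀ u v w : ℕ, ({u, v, w} : Multiset ℕ) = {v, u, w} := fun u v w =>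
      Multiset.cons_swap u v {w}
    have m2 : ∀ u v w : ℕ, ({u, v, w} : Multiset ℕ) = {u, w, v} := fun u v w =>
      congrArg (u ::ₘ ·) (Multiset.pair_comm v w)
    rintro (⟨rfl, rfl, rfl⟩ | ⟨rfl, rfl, rfl⟩ | ⟨rfl, rfl, rfl⟩ | ⟨rfl, rfl, rfl⟩ |
      ⟨rfl, rfl, rfl⟩ | ⟨rfl, rfl, rfl⟩)
    · rfl
    · exact m2 _ _ _
    · exact m1 _ _ _
    · rw [m2, m1]
    · rw [m1, m2]
    · rw [m1, m2, m1]

/-- Renaming the elements of a triple permutes its three distances, so an orbit is determined by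
the multiset of distances. -/
theorem hasTriple_cycleOrbit_iff {p q r : ℕ} {a b c : Fin 10} (hab : a ≠ b) (hbc : b ≠ c)
    (hac : a ≠ c) : HasTriple (cycleOrbit p q r) a b c ↔
      ({cycleDist a b, cycleDist b c, cycleDist a c} : Multiset ℕ) = {p, q, r} := by
  have hcard : ({a, b, c} : Finset (Fin 10)).card = 3 :=
    Finset.card_eq_three.2 ⟨a, b, c, hab, hac, hbc, rfl⟩
  rw [hasTriple_iff (x := ⟨{a, b, c}, hcard⟩) rfl, cycleOrbit, Finset.mem_filter]
  simp only [Finset.mem_univ, true_and]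
  constructor
  · rintro ⟨x, y, z, he, rfl, rfl, rfl⟩
    have hx : x ∈ ({a, b, c} : Finset (Fin 10)) := by rw [he]; simp
    have hy : y ∈ ({a, b, c} : Finset (Fin 10)) := by rw [he]; simp
    have hz : z ∈ ({a, b, c} : Finset (Fin 10)) := by rw [he]; simp
    rw [he] at hcard
    have hxy : x ≠ y := by
      rintro rfl
      rw [Finset.insert_eq_of_mem (Finset.mem_insert_self _ _)] at hcard
      have := Finset.card_le_two (a := x) (b := z)
      omega
    have hyz : y ≠ z := by
      rintro rfl
      rw [Finset.pair_eq_singleton] at hcard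
      have := Finset.card_le_two (a := x) (b := y)
      omega
    have hxz : x ≠ z := by
      rintro rfl
      rw [Finset.insert_eq_of_mem (Finset.mem_insert_of_mem (Finset.mem_singleton_self _))] at hcard
      have := Finset.card_le_two (a := y) (b := x)
      omega
    simp only [Finset.mem_insert, Finset.mem_singleton] at hx hy hz
    have hs := cycleDist_comm
    rw [multiset_triple_eq_iff]
    rcases hx with rfl | rfl | rfl <;> rcases hy with rfl | rfl | rfl <;>
      rcases hz with rfl | rfl | rfl <;> 
      first | contradiction | simp [hs y x, hs z x, hs z y]
  · have hs := cycleDist_comm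
    rw [multiset_triple_eq_iff]
    rintro (⟨h1, h2, h3⟩ | ⟨h1, h2, h3⟩ | ⟨h1, h2, h3⟩ | ⟨h1, h2, h3⟩ | ⟨h1, h2, h3⟩ | ⟨h1, h2, h3⟩)
    · exact ⟨a, b, c, rfl, h1, h2, h3⟩
    · exact ⟨b, a, c, Finset.insert_comm _ _ _, (hs _ _).trans h1, h3, h2⟩
    · exact ⟨c, b, a, by ext; simp; tauto, (hs _ _).trans h2, (hs _ _).trans h1, (hs _ _).trans h3⟩
    · exact ⟨c, a, b, by ext; simp; tauto, (hs _ _).trans h3, h1, (hs _ _).trans h2⟩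
    · exact ⟨b, c, a, by ext; simp; tauto, h2, (hs _ _).trans h3, (hs _ _).trans h1⟩
    · exact ⟨a, c, b, by ext; simp; tauto, h3, (hs _ _).trans h2, h1⟩

/-- The distance multisets of the orbits making up `coloringP i`. -/
def distancesP : Fin 2 → List (Multiset ℕ) :=
  ![[{1, 1, 2}, {1, 2, 3}, {1, 3, 4}, {3, 3, 4}], [{1, 4, 5}, {2, 2, 4}, {2, 3, 5}, {2, 4, 4}]]

/-- The distance multisets of the orbits making up `coloringP' i`. -/
def distancesP' : Fin 2 → List (Multiset ℕ) :=
  ![[{1, 3, 4}, {1, 4, 5}, {2, 4, 4}, {3, 3, 4}], [{1, 1, 2}, {1, 2, 3}, {2, 2, 4}, {2, 3, 5}]]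

theorem hasTriple_union {n : ℕ} {S T : Finset (JohnsonVertex n 3)} {a b c : Fin n} :
    HasTriple (S ∪ T) a b c ↔ HasTriple S a b c ∨ HasTriple T a b c := by
  simp only [HasTriple, Finset.map_union, Finset.mem_union]

theorem hasTriple_coloringP_iff (i : Fin 2) {a b c : Fin 10} (hab : a ≠ b) (hbc : b ≠ c)
    (hac : a ≠ c) : HasTriple (coloringP i) a b c ↔
      {cycleDist a b, cycleDist b c, cycleDist a c} ∈ distancesP i := by
  fin_cases i <;>
    simp [coloringP, distancesP, orbitA, orbitB, orbitC, orbitD, orbitE, orbitF, orbitG, orbitH,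
      hasTriple_union, hasTriple_cycleOrbit_iff hab hbc hac, -Multiset.insert_eq_cons]

theorem hasTriple_coloringP'_iff (i : Fin 2) {a b c : Fin 10} (hab : a ≠ b) (hbc : b ≠ c)
    (hac : a ≠ c) : HasTriple (coloringP' i) a b c ↔
      {cycleDist a b, cycleDist b c, cycleDist a c} ∈ distancesP' i := by
  fin_cases i <;>
    simp [coloringP', distancesP', orbitA, orbitB, orbitC, orbitD, orbitE, orbitF, orbitG, orbitH,
      hasTriple_union, hasTriple_cycleOrbit_iff hab hbc hac, -Multiset.insert_eq_cons]

theorem pairDegree_eq_card_distances {S : Finset (JohnsonVertex 10 3)} {L : List (Multiset ℕ)}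
    (h : ∀ a b c : Fin 10, a ≠ b → b ≠ c → a ≠ c →
      (HasTriple S a b c ↔ {cycleDist a b, cycleDist b c, cycleDist a c} ∈ L))
    {a b : Fin 10} (hab : a ≠ b) : pairDegree S a b = (((Finset.univ.erase a).erase b).filter
      (fun c => {cycleDist a b, cycleDist b c, cycleDist a c} ∈ L)).card := by
  rw [pairDegree_eq_card S hab]
  congr 1
  refine Finset.filter_congr fun c hc => ?_
  simp only [Finset.mem_erase, Finset.mem_univ, and_true] at hc
  exact h a b c hab hc.1.symm hc.2.symm

/-- On the ten-cycle the pair degree depends on the distance only; the list gives its values at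
distances `0, …, 5`, the entry at `0` being irrelevant. -/
theorem pairDegree_coloringP {a b : Fin 10} (hab : a ≠ b) :
    pairDegree (coloringP 0) a b = [0, 6, 3, 6, 3, 0].getD (cycleDist a b) 0 := by
  rw [pairDegree_eq_card_distances (fun _ _ _ => hasTriple_coloringP_iff 0) hab]
  revert a b
  decide +kernel

theorem pairDegree_coloringP' {a b : Fin 10} (hab : a ≠ b) :
    pairDegree (coloringP' 0) a b = [0, 4, 1, 4, 7, 4].getD (cycleDist a b) 0 := by
  rw [pairDegree_eq_card_distances (fun _ _ _ => hasTriple_coloringP'_iff 0) hab]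
  revert a b
  decide +kernel

theorem isOfType_coloringP : IsOfType (coloringP 0) 0 := by
  intro a b hab
  change pairDegree (coloringP 0) a b % 3 = 0
  rw [pairDegree_coloringP hab]
  revert a b
  decide +kernel

theorem isOfType_coloringP' : IsOfType (coloringP' 0) 1 := by
  intro a b hab
  change pairDegree (coloringP' 0) a b % 3 = 1
  rw [pairDegree_coloringP' hab]
  revert a b
  decide +kernel

theorem isHalf_coloringP : IsHalf (coloringP 0) := by
  intro a b c hab hbc hac
  rw [pairDegree_coloringP hab, pairDegree_coloringP hbc, pairDegree_coloringP hac]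
  simp only [hasTriple_coloringP_iff 0 hab hbc hac]
  revert a b c
  decide +kernel

theorem isHalf_coloringP' : IsHalf (coloringP' 0) := by
  intro a b c hab hbc hac
  rw [pairDegree_coloringP' hab, pairDegree_coloringP' hbc, pairDegree_coloringP' hac]
  simp only [hasTriple_coloringP'_iff 0 hab hbc hac]
  revert a b c
  decide +kernel

theorem coloringP_compl : (coloringP 0)ᶜ = coloringP 1 := by
  ext x
  obtain ⟨a, b, c, hab, hbc, hac, hx⟩ := x.exists_eq
  rw [Finset.mem_compl, ← hasTriple_iff hx, ← hasTriple_iff hx,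
    hasTriple_coloringP_iff 0 hab hbc hac, hasTriple_coloringP_iff 1 hab hbc hac]
  clear hx
  revert a b c
  decide +kernel

theorem coloringP'_compl : (coloringP' 0)ᶜ = coloringP' 1 := by
  ext x
  obtain ⟨a, b, c, hab, hbc, hac, hx⟩ := x.exists_eq
  rw [Finset.mem_compl, ← hasTriple_iff hx, ← hasTriple_iff hx,
    hasTriple_coloringP'_iff 0 hab hbc hac, hasTriple_coloringP'_iff 1 hab hbc hac]
  clear hx
  revert a b c
  decide +kernel

theorem isPerfectColoring_coloringP :
    IsPerfectColoring (johnsonGraph 10 3) coloringP quotientMatrix := by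
  refine isHalf_coloringP.isPerfectColoring coloringP_compl.symm fun i => ?_
  fin_cases i
  · exact ⟨⟨{0, 1, 2}, rfl⟩, (hasTriple_iff rfl).1
      ((hasTriple_coloringP_iff 0 (by decide) (by decide) (by decide)).2 (by decide +kernel))⟩
  · exact ⟨⟨{0, 5, 1}, rfl⟩, (hasTriple_iff rfl).1
      ((hasTriple_coloringP_iff 1 (by decide) (by decide) (by decide)).2 (by decide +kernel))⟩

theorem isPerfectColoring_coloringP' :
    IsPerfectColoring (johnsonGraph 10 3) coloringP' quotientMatrix := by
  refine isHalf_coloringP'.isPerfectColoring coloringP'_compl.symm fun i => ?_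
  fin_cases i
  · exact ⟨⟨{0, 5, 1}, rfl⟩, (hasTriple_iff rfl).1
      ((hasTriple_coloringP'_iff 0 (by decide) (by decide) (by decide)).2 (by decide +kernel))⟩
  · exact ⟨⟨{0, 1, 2}, rfl⟩, (hasTriple_iff rfl).1
      ((hasTriple_coloringP'_iff 1 (by decide) (by decide) (by decide)).2 (by decide +kernel))⟩

/-! ### Non-isomorphism -/

/-- Some edge of `G` lies in `S` together with all common neighbours of its ends. -/
def HasSaturatedEdge {V : Type*} (G : SimpleGraph V) (S : Finset V) : Prop :=
  ∃ x ∈ S, ∃ y ∈ S, G.Adj x y ∧ ∀ z, G.Adj x z → G.Adj y z → z ∈ S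

theorem HasSaturatedEdge.map {V : Type*} {G : SimpleGraph V} {S T : Finset V}
    (h : HasSaturatedEdge G S) (φ : G ≃g G) (hφ : ∀ x, x ∈ S ↔ φ x ∈ T) : HasSaturatedEdge G T := by
  obtain ⟨x, hx, y, hy, hxy, hz⟩ := h
  refine ⟨φ x, (hφ x).1 hx, φ y, (hφ y).1 hy, φ.map_adj_iff.2 hxy, fun z hxz hyz => ?_⟩
  rw [← φ.apply_symm_apply z] at hxz hyz ⊢
  exact (hφ _).1 (hz _ (φ.map_adj_iff.1 hxz) (φ.map_adj_iff.1 hyz))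

/-- All triples containing an antipodal pair of the ten-cycle lie in the second part. The edge joins
two of them whose further common neighbours lie there as well. -/
theorem hasSaturatedEdge_coloringP : HasSaturatedEdge (johnsonGraph 10 3) (coloringP 1) := by
  have hmem : ∀ (x : JohnsonVertex 10 3) (a b c : Fin 10), a ≠ b → b ≠ c → a ≠ c →
      x.1 = {a, b, c} → {cycleDist a b, cycleDist b c, cycleDist a c} ∈ distancesP 1 →
      x ∈ coloringP 1 := fun x a b c hab hbc hac hx h =>
    (hasTriple_iff hx).1 ((hasTriple_coloringP_iff 1 hab hbc hac).2 h)
  refine ⟨⟨{0, 5, 1}, rfl⟩, hmem _ 0 5 1 (by decide) (by decide) (by decide) rfl (by decide +kernel),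
    ⟨{0, 5, 6}, rfl⟩, hmem _ 0 5 6 (by decide) (by decide) (by decide) rfl (by decide +kernel),
    johnsonGraph_adj_iff.2 (by decide), fun z h1 h2 => ?_⟩
  obtain ⟨a, b, c, hab, hbc, hac, hz⟩ := z.exists_eq
  rw [johnsonGraph_adj_iff, hz] at h1 h2
  refine hmem z a b c hab hbc hac hz ?_
  clear hz hmem
  revert a b c
  decide +kernel

/-- In a set of type `1` every pair has degree at most `7`, so the two points common to the ends of
an edge lie in a triple outside the set. -/
theorem IsOfType.not_hasSaturatedEdge {S : Finset (JohnsonVertex 10 3)} (h : IsOfType S 1) :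
    ¬ HasSaturatedEdge (johnsonGraph 10 3) S := by
  rintro ⟨x, hx, y, hy, hxy, hz⟩
  rw [johnsonGraph_adj_iff] at hxy
  obtain ⟨a, b, hab, hi⟩ := Finset.card_eq_two.1 hxy
  have ha : a ∈ x.1 ∩ y.1 := by simp [hi]
  have hb : b ∈ x.1 ∩ y.1 := by simp [hi]
  rw [Finset.mem_inter] at ha hb
  obtain ⟨c, hca, hcb, hc⟩ : ∃ c, c ≠ a ∧ c ≠ b ∧ ¬ HasTriple S a b c := by
    by_contra! hall
    have h1 : pairDegree S a b = pairDegree Finset.univ a b := by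
      rw [pairDegree_eq_card S hab, pairDegree_eq_card Finset.univ hab]
      congr 1
      refine Finset.filter_congr fun c hc => ?_
      simp only [Finset.mem_erase, Finset.mem_univ, and_true] at hc
      refine iff_of_true (hall c hc.2 hc.1) ((hasTriple_iff (x := ⟨{a, b, c}, ?_⟩) rfl).2
        (Finset.mem_univ _))
      exact Finset.card_eq_three.2 ⟨a, b, c, hab, hc.2.symm, hc.1.symm, rfl⟩
    have h2 : pairDegree S a b % 3 = 1 := h a b hab
    rw [h1, pairDegree_univ hab] at h2
    omega
  set z : JohnsonVertex 10 3 :=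
    ⟨{a, b, c}, Finset.card_eq_three.2 ⟨a, b, c, hab, hca.symm, hcb.symm, rfl⟩⟩ with hz'
  have hzS : z ∉ S := fun hzS => hc ((hasTriple_iff (x := z) rfl).2 hzS)
  have hadj : ∀ u ∈ S, a ∈ u.1 → b ∈ u.1 → (johnsonGraph 10 3).Adj u z := by
    intro u hu hau hbu
    rw [johnsonGraph_adj_iff]
    have hcu : c ∉ u.1 := by
      intro hcu
      have hsub : z.1 ⊆ u.1 := by simp [hz', Finset.insert_subset_iff, hau, hbu, hcu]
      have : z = u := Subtype.ext (Finset.eq_of_subset_of_card_le hsub (by rw [u.2, z.2]))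
      exact hzS (this ▸ hu)
    have : u.1 ∩ z.1 = {a, b} := by
      ext d
      simp only [hz', Finset.mem_inter, Finset.mem_insert, Finset.mem_singleton]
      constructor
      · rintro ⟨hd, rfl | rfl | rfl⟩
        · exact Or.inl rfl
        · exact Or.inr rfl
        · exact absurd hd hcu
      · rintro (rfl | rfl)
        · exact ⟨hau, Or.inl rfl⟩
        · exact ⟨hbu, Or.inr (Or.inl rfl)⟩
    rw [this, Finset.card_pair hab]
  exact hzS (hz z (hadj x hx ha.1 hb.1) (hadj y hy ha.2 hb.2))

theorem not_coloringIso : ¬ ColoringIso (johnsonGraph 10 3) coloringP coloringP' := by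
  rintro ⟨φ, σ, h⟩
  have h1 := hasSaturatedEdge_coloringP.map φ (h 1)
  have h2 : ∀ i, IsOfType (coloringP' i) 1 := by
    rw [Fin.forall_fin_two, ← coloringP'_compl]
    exact ⟨isOfType_coloringP', isOfType_coloringP'.compl (by decide)⟩
  exact (h2 _).not_hasSaturatedEdge h1

/-! ### The eigenvalue condition -/

/-- The second eigenvalue of a symmetric `2 × 2` matrix with row sums `21` and off-diagonal entry `q`
is `21 - 2 q`, and it equals `3` exactly when `q = 9`. -/
theorem isSymmetricThetaTwoColoring_iff (X : Fin 2 → Finset (JohnsonVertex 10 3)) :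
    IsSymmetricThetaTwoColoring 10 3 X ↔
      IsPerfectColoring (johnsonGraph 10 3) X quotientMatrix := by
  have hθ : johnsonEigenvalue 10 3 2 = 3 := by norm_num [johnsonEigenvalue]
  constructor
  · rintro ⟨M, hM, hs, he⟩
    -- the rows of the quotient matrix sum to the degree `21`
    have hrow : ∀ i, M i 0 + M i 1 = 21 := by
      intro i
      obtain ⟨x, hx⟩ := hM.nonempty i
      rw [← hM.count i 0 x hx, ← hM.count i 1 x hx, ← hM.compl_eq]
      exact card_neighborFinset_inter_compl _ x
    have h01 : M 1 0 = M 0 1 := hs.apply 0 1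
    obtain ⟨v, hv⟩ := he.exists_hasEigenvector
    have hv1 := hv.apply_eq_smul
    have hv0 := hv.2
    rw [hθ] at hv1
    have e0 := congrFun hv1 0
    have e1 := congrFun hv1 1
    simp only [Matrix.toLin'_apply, Matrix.mulVec, dotProduct, Fin.sum_univ_two, Matrix.map_apply,
      Pi.smul_apply, smul_eq_mul, h01] at e0 e1
    have r0 : (M 0 0 : ℝ) + M 0 1 = 21 := by exact_mod_cast hrow 0
    have r1 : (M 0 1 : ℝ) + M 1 1 = 21 := by rw [← h01]; exact_mod_cast hrow 1
    have hsum : v 0 + v 1 = 0 := by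
      have : (18 : ℝ) * (v 0 + v 1) = 0 := by linear_combination e0 + e1 - v 0 * r0 - v 1 * r1
      linarith
    have hv0' : v 0 ≠ 0 := by
      intro h0
      apply hv0
      ext i
      fin_cases i
      · exact h0
      · change v 1 = 0; linarith
    have h9 : (M 0 1 : ℝ) = 9 := by
      have : v 0 * ((M 0 1 : ℝ) - 9) = 0 := by
        have : v 1 = - v 0 := by linarith
        rw [this] at e0
        linear_combination (- e0 + v 0 * r0) / 2
      have := (mul_eq_zero.1 this).resolve_left hv0'
      linarith
    have h9' : M 0 1 = 9 := by exact_mod_cast h9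
    have hMq : M = quotientMatrix := by
      have := hrow 0
      have := hrow 1
      ext i j
      fin_cases i <;> fin_cases j <;> simp [quotientMatrix] <;> omega
    exact hMq ▸ hM
  · intro h
    refine ⟨quotientMatrix, h, by decide, ?_⟩
    rw [hθ]
    refine Module.End.hasEigenvalue_of_hasEigenvector (x := ![1, -1]) ⟨?_, ?_⟩
    · rw [Module.End.mem_eigenspace_iff]
      ext i
      fin_cases i <;>
        simp [quotientMatrix, Matrix.toLin'_apply, Matrix.mulVec, dotProduct, Fin.sum_univ_two] <;>
        norm_num
    · intro h0
      simpa using congrFun h0 0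

/-! ### Classification -/

theorem IsPerfectColoring.coloringIso_coloringP' {X : Fin 2 → Finset (JohnsonVertex 10 3)}
    (h : IsPerfectColoring (johnsonGraph 10 3) X quotientMatrix) {i : Fin 2}
    (hi : IsOfType (X i) 1) : ColoringIso (johnsonGraph 10 3) X coloringP' := by
  obtain ⟨φ, hφ⟩ := (h.isHalf i).exists_iso isHalf_coloringP'
    ((h.isHalf i).hasLabelling_pentagonWeight hi)
    (isHalf_coloringP'.hasLabelling_pentagonWeight isOfType_coloringP')
  exact coloringIso_of_iso h.compl_eq coloringP'_compl φ hφ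

theorem IsPerfectColoring.coloringIso_coloringP {X : Fin 2 → Finset (JohnsonVertex 10 3)}
    (h : IsPerfectColoring (johnsonGraph 10 3) X quotientMatrix) {i : Fin 2}
    (hi : IsOfType (X i) 2) : ColoringIso (johnsonGraph 10 3) X coloringP := by
  have hP := isPerfectColoring_coloringP.isHalf 1
  have ht : IsOfType (coloringP 1) 2 := by
    rw [← coloringP_compl]; exact isOfType_coloringP.compl (by decide)
  obtain ⟨φ, hφ⟩ := (h.isHalf i).exists_iso hP ((h.isHalf i).hasLabelling_matchingWeight hi)
    (hP.hasLabelling_matchingWeight ht)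
  exact coloringIso_of_iso h.compl_eq coloringP_compl φ hφ

theorem theorem2 :
    -- up to isomorphism, `{P₁', P₂'}` is the only coloring with a part of type 1
    (IsPerfectColoring (johnsonGraph 10 3) coloringP' quotientMatrix ∧
      IsOfType (coloringP' 0) 1 ∧ IsOfType (coloringP' 1) 1 ∧
      (∃ φ : johnsonGraph 10 3 ≃g johnsonGraph 10 3,
        ∀ x, x ∈ coloringP' 0 ↔ φ x ∈ coloringP' 1) ∧
      ∀ X : Fin 2 → Finset (JohnsonVertex 10 3),
        IsPerfectColoring (johnsonGraph 10 3) X quotientMatrix →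
        (∃ i, IsOfType (X i) 1) →
        ColoringIso (johnsonGraph 10 3) X coloringP') ∧
    -- up to isomorphism, there are exactly two symmetric colorings with eigenvalue `θ_2`
    (IsPerfectColoring (johnsonGraph 10 3) coloringP quotientMatrix ∧
      IsOfType (coloringP 0) 0 ∧ IsOfType (coloringP 1) 2 ∧
      ¬ ColoringIso (johnsonGraph 10 3) coloringP coloringP' ∧
      (∀ X : Fin 2 → Finset (JohnsonVertex 10 3),
        IsSymmetricThetaTwoColoring 10 3 X ↔
          IsPerfectColoring (johnsonGraph 10 3) X quotientMatrix) ∧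
      ∀ X : Fin 2 → Finset (JohnsonVertex 10 3),
        IsSymmetricThetaTwoColoring 10 3 X →
        ColoringIso (johnsonGraph 10 3) X coloringP ∨
          ColoringIso (johnsonGraph 10 3) X coloringP') := by
  have hP'1 : IsOfType (coloringP' 1) 1 := by
    rw [← coloringP'_compl]; exact isOfType_coloringP'.compl (by decide)
  have hP1 : IsOfType (coloringP 1) 2 := by
    rw [← coloringP_compl]; exact isOfType_coloringP.compl (by decide)
  refine ⟨⟨isPerfectColoring_coloringP', isOfType_coloringP', hP'1, ?_,
    fun X hX ⟨i, hi⟩ => hX.coloringIso_coloringP' hi⟩, isPerfectColoring_coloringP,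
    isOfType_coloringP, hP1, not_coloringIso, isSymmetricThetaTwoColoring_iff, fun X hX => ?_⟩
  · have h1 := isPerfectColoring_coloringP'.isHalf 1
    exact isHalf_coloringP'.exists_iso h1
      (isHalf_coloringP'.hasLabelling_pentagonWeight isOfType_coloringP')
      (h1.hasLabelling_pentagonWeight hP'1)
  · rw [isSymmetricThetaTwoColoring_iff] at hX
    obtain ⟨t, ht⟩ := (hX.isHalf 0).exists_isOfType
    fin_cases t
    · -- the complement of a part of type `0` has type `2`
      refine Or.inl (hX.coloringIso_coloringP (i := 1) ?_)
      rw [← hX.compl_eq]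
      exact ht.compl (by decide)
    · exact Or.inr (hX.coloringIso_coloringP' ht)
    · exact Or.inl (hX.coloringIso_coloringP ht)
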